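/- Let $G$ be a finite group. For $x,y\in G$ put $[x,y]=x^{-1}y^{-1}xy$, let $K(G)=\{[x,y] : x,y\in G\}$ be the set of commutators, and let $G'$ be the commutator subgroup of $G$. For $g\in G$ put $$\mathrm{Pr}_g(G)=\frac{|\{(x,y)\in G\times G : [x,y]=g\}|}{|G|^2},\qquad P(G)=\{\mathrm{Pr}_g(G) : 1\neq g\in K(G)\}.$$ For an integer $m>1$, say that $G$ is of conjugate type $(1,m)$ if every non-central element of $G$ has exactly $m$ conjugates in $G$. Let $p$ be a prime, $n\geq 1$ an integer, and $G$ a finite $p$-group of nilpotency class $3$ and conjugate type $(1,p^{2n})$. Then for every $g\in G'$, $$\mathrm{Pr}_g(G)=\begin{cases}\dfrac{p^{3n}+p^{2n}-1}{p^{5n}}, & \text{if } g=1,\\[2ex] \dfrac{p^{2n}-1}{p^{5n}}, & \text{if } g\neq 1.\end{cases}$$ Hence $|P(G)|=1$. -/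

import Mathlib

/-- The commutator `[x, y] = x⁻¹ y⁻¹ x y` (Mathlib's `⁅x, y⁆` is `x y x⁻¹ y⁻¹` instead). -/
def groupComm {G : Type*} [Group G] (x y : G) : G := x⁻¹ * y⁻¹ * x * y

/-- The fiber of `g` under the commutator word map: all pairs `(x, y)` with `[x, y] = g`. -/
def commFiber {G : Type*} [Group G] (g : G) : Set (G × G) := {q | groupComm q.1 q.2 = g}

/-- The set `K(G)` of all commutators of `G` (a subset, not the subgroup it generates). -/
def commSet (G : Type*) [Group G] : Set G := {g | ∃ x y : G, groupComm x y = g}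

/-- `Pr_g(G)`, the proportion of pairs `(x, y)` in `G × G` with `[x, y] = g`. -/
noncomputable def commPr {G : Type*} [Group G] (g : G) : ℚ :=
  (Nat.card (commFiber g) : ℚ) / (Nat.card G : ℚ) ^ 2

/-- `P(G) = {Pr_g(G) | 1 ≠ g ∈ K(G)}`. -/
def commPrSet (G : Type*) [Group G] : Set ℚ := {r | ∃ g ∈ commSet G, g ≠ 1 ∧ commPr g = r}

/-- `G` is of conjugate type `(1, m)`: `m > 1` and every non-central element of `G` has exactly
`m` conjugates. -/
def IsConjugateType (G : Type*) [Group G] (m : ℕ) : Prop :=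
  1 < m ∧ ∀ g : G, g ∉ Subgroup.center G → Nat.card (conjugatesOf g) = m

/-! Write `Z` for the centre, `Z₂` for the second centre, `C(x) = {z : ⁅x, z⁆ ∈ Z}` and `D(x) = {⁅x,
z⁆ : z ∈ C(x)}`, and let `q = p ^ n`. All centralizers of noncentral elements have the same order,
and this rigidity turns inclusions into equalities.

If `c = ⁅x, y⁆` is noncentral, the Hall–Witt identity in class 3 shows that `z ↦ ⁅c, z⁆` maps `C(y)`
into `D(y)`. Since `c` and `y` have centralizers of equal order, counting forces the image to be all
of `D(y)` and the centralizer of `c` to lie in `C(y)` (`map_centralizerMod_eq_and_centralizer_le`).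
From this follow `G = C(x)C(y)`, `C(x) ∩ C(y) = Z₂` and the fact that `c` has centralizer `Z₂`.
Hence `|Z₂| = q|Z|`, `|C(x)| = q²|Z|` and `|G| = q³|Z|`; moreover `D(x) ∩ D(y) = 1` and `Z₂` is
abelian.

For noncentral `c ∈ Z₂` put `W = ⁅c, G⁆`. It does not depend on `c`, contains every central
commutator, and `⁅x, G⁆` covers `G'` modulo `W` for each `x ∉ Z₂` (`exists_commutator_mul_eq`).

Now fix `1 ≠ g ∈ G'` and count the `x` for which `⁅x, y⁆ = g` is solvable. If `g` is central, they
form `C(t) \ Z` for some `t ∉ Z₂`; if not, they form one coset of `Z` inside each of the `q² - 1`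
nontrivial cosets of `Z₂`. Either way there are `(q² - 1)|Z|` of them, and each admits `|Z₂| = q|Z|`
values of `y`. -/

section Structure

open Subgroup
open scoped commutatorElement

/-! ### Commutator identities modulo the centre -/

section CommutatorCalculus

variable {G : Type*} [Group G]

theorem commutatorElement_mul_right_of_mem_center {x z : G} (y : G) (h : ⁅x, z⁆ ∈ center G) :
    ⁅x, y * z⁆ = ⁅x, y⁆ * ⁅x, z⁆ := by
  have h1 : y * ⁅x, z⁆ * y⁻¹ = ⁅x, z⁆ := by rw [mem_center_iff.1 h y]; group
  calc ⁅x, y * z⁆ = ⁅x, y⁆ * (y * ⁅x, z⁆ * y⁻¹) := by simp only [commutatorElement_def]; group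
    _ = _ := by rw [h1]

theorem commutatorElement_mul_left_of_mem_center {y z : G} (x : G) (h : ⁅z, y⁆ ∈ center G) :
    ⁅x * z, y⁆ = ⁅x, y⁆ * ⁅z, y⁆ := by
  have h1 : x * ⁅z, y⁆ * x⁻¹ = ⁅z, y⁆ := by rw [mem_center_iff.1 h x]; group
  calc ⁅x * z, y⁆ = (x * ⁅z, y⁆ * x⁻¹) * ⁅x, y⁆ := by simp only [commutatorElement_def]; group
    _ = _ := by rw [h1, mem_center_iff.1 h]

theorem commutatorElement_swap_mem_center {x y : G} (h : ⁅x, y⁆ ∈ center G) :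
    ⁅y, x⁆ ∈ center G := by
  rw [← commutatorElement_inv]; exact inv_mem h

theorem commutatorElement_inv_right_of_mem_center {x y : G} (h : ⁅x, y⁆ ∈ center G) :
    ⁅x, y⁻¹⁆ = ⁅x, y⁆⁻¹ := by
  have h2 := commutatorElement_mul_right_of_mem_center y⁻¹ h
  rw [inv_mul_cancel, commutatorElement_one_right] at h2
  exact eq_inv_of_mul_eq_one_left h2.symm

theorem commutatorElement_inv_left_of_mem_center {x y : G} (h : ⁅x, y⁆ ∈ center G) :
    ⁅x⁻¹, y⁆ = ⁅x, y⁆⁻¹ := by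
  have h2 := commutatorElement_mul_left_of_mem_center x⁻¹ h
  rw [inv_mul_cancel, commutatorElement_one_left] at h2
  exact eq_inv_of_mul_eq_one_left h2.symm

theorem commutatorElement_eq_one_of_mem_center_right {k : G} (hk : k ∈ center G) (x : G) :
    ⁅x, k⁆ = 1 := commutatorElement_eq_one_iff_mul_comm.2 (mem_center_iff.1 hk x)

theorem commutatorElement_eq_one_of_mem_center_left {k : G} (hk : k ∈ center G) (x : G) :
    ⁅k, x⁆ = 1 := commutatorElement_eq_one_iff_mul_comm.2 (mem_center_iff.1 hk x).symm

theorem commutatorElement_mul_center_left {k : G} (hk : k ∈ center G) (x y : G) :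
    ⁅x * k, y⁆ = ⁅x, y⁆ := by
  have h := commutatorElement_eq_one_of_mem_center_left hk y
  rw [commutatorElement_mul_left_of_mem_center x (by rw [h]; exact one_mem _), h, mul_one]

/-- The centralizer of `x` modulo the centre of `G`. -/
def centralizerMod (x : G) : Subgroup G :=
  (centralizer {QuotientGroup.mk' (center G) x}).comap (QuotientGroup.mk' (center G))

theorem mem_centralizerMod {x z : G} : z ∈ centralizerMod x ↔ ⁅x, z⁆ ∈ center G := by
  rw [centralizerMod, mem_comap, mem_centralizer_singleton_iff, ← QuotientGroup.eq_one_iff,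
    ← QuotientGroup.mk'_apply, map_commutatorElement, commutatorElement_eq_one_iff_mul_comm]
  exact eq_comm

theorem mem_centralizerMod_comm {x z : G} : z ∈ centralizerMod x ↔ x ∈ centralizerMod z := by
  rw [mem_centralizerMod, mem_centralizerMod]
  exact ⟨commutatorElement_swap_mem_center, commutatorElement_swap_mem_center⟩

variable (G) in
/-- The second centre of `G`. -/
def secondCenter : Subgroup G :=
  (center (G ⧸ center G)).comap (QuotientGroup.mk' (center G))

instance : (secondCenter G).Normal := by unfold secondCenter; infer_instance

theorem mem_secondCenter {z : G} : z ∈ secondCenter G ↔ ∀ x, z ∈ centralizerMod x := by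
  simp only [secondCenter, centralizerMod, mem_comap, mem_center_iff,
    mem_centralizer_singleton_iff]
  constructor
  · intro h x; exact (h _).symm
  · intro h x
    obtain ⟨x, rfl⟩ := QuotientGroup.mk'_surjective _ x
    exact (h x).symm

theorem secondCenter_le_centralizerMod (x : G) : secondCenter G ≤ centralizerMod x :=
  fun _ hz => mem_secondCenter.1 hz x

theorem center_le_secondCenter : center G ≤ secondCenter G := fun z hz =>
  mem_secondCenter.2 fun x => mem_centralizerMod.2 <| by
    rw [commutatorElement_eq_one_of_mem_center_right hz]; exact one_mem _

theorem commutatorElement_mem_center_right {z : G} (hz : z ∈ secondCenter G) (x : G) :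
    ⁅x, z⁆ ∈ center G := mem_centralizerMod.1 (mem_secondCenter.1 hz x)

theorem commutatorElement_mem_center_left {z : G} (hz : z ∈ secondCenter G) (x : G) :
    ⁅z, x⁆ ∈ center G := commutatorElement_swap_mem_center (commutatorElement_mem_center_right hz x)

theorem exists_notMem_centralizerMod {x : G} (hx : x ∉ secondCenter G) :
    ∃ y, y ∉ centralizerMod x := by
  rw [mem_secondCenter] at hx
  push Not at hx
  obtain ⟨y, hy⟩ := hx
  exact ⟨y, fun h => hy (mem_centralizerMod_comm.1 h)⟩

theorem notMem_secondCenter_of_notMem_centralizerMod {x y : G} (h : y ∉ centralizerMod x) :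
    x ∉ secondCenter G := fun hx => h (mem_centralizerMod_comm.1 (mem_secondCenter.1 hx y))

theorem centralizer_le_centralizerMod (x : G) : centralizer {x} ≤ centralizerMod x := fun z hz => by
  rw [mem_centralizerMod, commutatorElement_eq_one_iff_mul_comm.2
    (mem_centralizer_singleton_iff.1 hz).symm]
  exact one_mem _

theorem mem_centralizer_singleton_iff_commutatorElement {x z : G} :
    z ∈ centralizer {x} ↔ ⁅x, z⁆ = 1 := by
  rw [mem_centralizer_singleton_iff, commutatorElement_eq_one_iff_mul_comm]
  exact eq_comm

/-- A second central element commutes with every commutator. -/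
theorem commutatorElement_mul_comm_of_mem_secondCenter {a : G} (ha : a ∈ secondCenter G) (x y : G) :
    a * ⁅x, y⁆ = ⁅x, y⁆ * a := by
  have hconj : ∀ x, a * x * a⁻¹ = x * ⁅a, x⁆ := fun x => by
    rw [mem_center_iff.1 (commutatorElement_mem_center_left ha x) x, commutatorElement_def]; group
  have h : a * ⁅x, y⁆ * a⁻¹ = ⁅x, y⁆ := by
    calc a * ⁅x, y⁆ * a⁻¹ = ⁅a * x * a⁻¹, a * y * a⁻¹⁆ := by
          simp only [commutatorElement_def]; group
      _ = ⁅x, y⁆ := by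
          rw [hconj, hconj,
            commutatorElement_mul_center_left (commutatorElement_mem_center_left ha x),
            ← commutatorElement_inv,
            commutatorElement_mul_center_left (commutatorElement_mem_center_left ha y),
            commutatorElement_inv]
  exact mul_inv_eq_iff_eq_mul.1 h

/-- The homomorphism `z ↦ ⁅x, z⁆` on the centralizer of `x` modulo the centre. -/
def commutatorHom (x : G) : centralizerMod x →* G where
  toFun z := ⁅x, (z : G)⁆
  map_one' := by simp
  map_mul' y z := by
    rw [coe_mul, commutatorElement_mul_right_of_mem_center _ (mem_centralizerMod.1 z.2)]

/-- The commutators `⁅x, z⁆` that lie in the centre. -/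
def centralCommutators (x : G) : Subgroup G := (commutatorHom x).range

theorem mem_centralCommutators {x g : G} :
    g ∈ centralCommutators x ↔ ∃ z ∈ centralizerMod x, ⁅x, z⁆ = g := by
  constructor
  · rintro ⟨⟨z, hz⟩, rfl⟩; exact ⟨z, hz, rfl⟩
  · rintro ⟨z, hz, rfl⟩; exact ⟨⟨z, hz⟩, rfl⟩

theorem card_mul_card_centralCommutators (x : G) :
    Nat.card (centralizer {x}) * Nat.card (centralCommutators x) = Nat.card (centralizerMod x) := by
  have h : (commutatorHom x).ker = (centralizer {x}).subgroupOf (centralizerMod x) := by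
    ext z
    rw [MonoidHom.mem_ker, mem_subgroupOf, mem_centralizer_singleton_iff_commutatorElement]
    rfl
  rw [centralCommutators, ← index_ker, h, ← Nat.card_congr
    (subgroupOfEquivOfLe (centralizer_le_centralizerMod x)).toEquiv, card_mul_index]

end CommutatorCalculus

/-- A group of nilpotency class three in which the centralizers of all noncentral elements
have the same index `q ^ 2`. -/
structure IsClassThreeOfConjugateType (G : Type*) [Group G] (q : ℕ) : Prop where
  commutator_mem : ∀ x y : G, ⁅x, y⁆ ∈ secondCenter G
  card_centralizer : ∀ x : G, x ∉ center G → q ^ 2 * Nat.card (centralizer {x}) = Nat.card G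
  exists_notMem : ∃ x y : G, y ∉ centralizerMod x

/-! ### The Hall–Witt identity in class three -/

namespace IsClassThreeOfConjugateType

variable {G : Type*} [Group G] {q : ℕ}

theorem commutator_mem_center (h : IsClassThreeOfConjugateType G q) (x y z : G) :
    ⁅x, ⁅y, z⁆⁆ ∈ center G := commutatorElement_mem_center_right (h.commutator_mem y z) x

/-- Expand `⁅x, y * z⁆` directly, and again after writing `y * z = ⁅y, z⁆ * (z * y)`. The triple
commutators are central, and elements of `Z₂` commute with commutators. -/
theorem jacobi (h : IsClassThreeOfConjugateType G q) (x y z : G) :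
    ⁅y, ⁅x, z⁆⁆ = ⁅x, ⁅y, z⁆⁆ * ⁅z, ⁅x, y⁆⁆ := by
  have hE : ∀ y z : G, ⁅x, y * z⁆ = ⁅y, ⁅x, z⁆⁆ * (⁅x, y⁆ * ⁅x, z⁆) := fun y z => by
    calc ⁅x, y * z⁆ = ⁅x, y⁆ * ⁅y, ⁅x, z⁆⁆ * ⁅x, z⁆ := by simp only [commutatorElement_def]; group
      _ = _ := by rw [mem_center_iff.1 (h.commutator_mem_center y x z), mul_assoc]
  have h1 : ⁅x, y * z⁆ = ⁅x, ⁅y, z⁆⁆ * ⁅x, z * y⁆ := by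
    have h2 := commutatorElement_mul_comm_of_mem_secondCenter (h.commutator_mem y z) x (z * y)
    calc ⁅x, y * z⁆ = ⁅x, ⁅y, z⁆ * (z * y)⁆ := by
          congr 1; simp only [commutatorElement_def]; group
      _ = ⁅x, ⁅y, z⁆⁆ * (⁅y, z⁆ * ⁅x, z * y⁆ * ⁅y, z⁆⁻¹) := by
          generalize ⁅y, z⁆ = c
          simp only [commutatorElement_def]; group
      _ = _ := by rw [h2, mul_inv_cancel_right]
  rw [hE, hE, commutatorElement_mul_comm_of_mem_secondCenter (h.commutator_mem x y) x z,
    ← mul_assoc ⁅x, ⁅y, z⁆⁆] at h1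
  exact mul_right_cancel h1

theorem card_centralizer_eq (h : IsClassThreeOfConjugateType G q) [Finite G] {x y : G}
    (hx : x ∉ center G) (hy : y ∉ center G) :
    Nat.card (centralizer {x}) = Nat.card (centralizer {y}) := by
  have h1 := (h.card_centralizer x hx).trans (h.card_centralizer y hy).symm
  have h2 : 0 < q ^ 2 := Nat.pos_of_ne_zero fun h0 => by
    have := h.card_centralizer x hx
    rw [h0, zero_mul] at this
    exact Nat.card_pos.ne this
  exact Nat.eq_of_mul_eq_mul_left h2 h1

end IsClassThreeOfConjugateType

section
variable {G : Type*} [Group G]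

/-- For a second central element `c`, the endomorphism `z ↦ ⁅c, z⁆` of `G`. -/
def secondCenterHom (c : G) (hc : c ∈ secondCenter G) : G →* G where
  toFun z := ⁅c, z⁆
  map_one' := by simp
  map_mul' y z :=
    commutatorElement_mul_right_of_mem_center _ (commutatorElement_mem_center_left hc z)

theorem ker_secondCenterHom (c : G) (hc : c ∈ secondCenter G) :
    (secondCenterHom c hc).ker = centralizer {c} := by
  ext z
  rw [MonoidHom.mem_ker, mem_centralizer_singleton_iff_commutatorElement]
  rfl

theorem card_inf_ker_mul_card_map {H : Type*} [Group H] (f : G →* H) (K : Subgroup G) :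
    Nat.card (K ⊓ f.ker : Subgroup G) * Nat.card (K.map f) = Nat.card K := by
  rw [← relIndex_ker, ← inf_relIndex_left, relIndex]
  rw [← Nat.card_congr (subgroupOfEquivOfLe (inf_le_left : K ⊓ f.ker ≤ K)).toEquiv,
    card_mul_index]

end

/-! ### Centralizers of noncentral commutators -/

namespace IsClassThreeOfConjugateType

variable {G : Type*} [Group G] {q : ℕ}

theorem commutator_commutator_eq (h : IsClassThreeOfConjugateType G q) {x y z : G}
    (hz : z ∈ centralizerMod y) : ⁅⁅x, y⁆, z⁆ = ⁅y, ⁅x, z⁆⁻¹⁆ := by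
  have h1 := h.jacobi x y z
  rw [commutatorElement_eq_one_of_mem_center_right (mem_centralizerMod.1 hz), one_mul] at h1
  rw [commutatorElement_inv_right_of_mem_center (h.commutator_mem_center _ _ _), h1,
    commutatorElement_inv]

/-- With `f = ⁅⁅x, y⁆, ·⁆`, the order of `C(y)` is `|C(y) ∩ ker f| · |f(C(y))|` and also `|C_G(y)| ·
|D(y)|`. Each factor of the first product is at most the matching factor of the second, because `ker
f` has order `|C_G(y)|`; so both bounds are attained. -/
theorem map_centralizerMod_eq_and_centralizer_le [Finite G] (h : IsClassThreeOfConjugateType G q)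
    {x y : G} (hxy : y ∉ centralizerMod x) :
    (centralizerMod y).map (secondCenterHom _ (h.commutator_mem x y)) = centralCommutators y ∧
      centralizer {⁅x, y⁆} ≤ centralizerMod y := by
  set f := secondCenterHom _ (h.commutator_mem x y) with hf
  have hker : f.ker = centralizer {⁅x, y⁆} := ker_secondCenterHom _ _
  have hc : ⁅x, y⁆ ∉ center G := fun hc => hxy (mem_centralizerMod.2 hc)
  have hy : y ∉ center G := fun hy => hxy (secondCenter_le_centralizerMod x
    (center_le_secondCenter hy))
  have hle : (centralizerMod y).map f ≤ centralCommutators y := by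
    rintro _ ⟨z, hz, rfl⟩
    refine mem_centralCommutators.2 ⟨⁅x, z⁆⁻¹, ?_, (h.commutator_commutator_eq hz).symm⟩
    exact inv_mem (secondCenter_le_centralizerMod y (h.commutator_mem x z))
  have h1 := card_inf_ker_mul_card_map f (centralizerMod y)
  rw [← card_mul_card_centralCommutators, hker, ← h.card_centralizer_eq hc hy] at h1
  have hinf : Nat.card (centralizerMod y ⊓ centralizer {⁅x, y⁆} : Subgroup G) ≤
      Nat.card (centralizer {⁅x, y⁆}) := card_le_of_le inf_le_right
  have hmap : Nat.card ((centralizerMod y).map f) ≤ Nat.card (centralCommutators y) :=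
    card_le_of_le hle
  have hpos : 0 < Nat.card (centralizer {⁅x, y⁆}) := Nat.card_pos
  have hpos' : 0 < Nat.card (centralCommutators y) := Nat.card_pos
  constructor
  · refine eq_of_le_of_card_ge hle ?_
    by_contra! hlt
    exact absurd h1 (Nat.mul_lt_mul_of_le_of_lt hinf hlt hpos).ne
  · refine le_of_inf_eq' (eq_of_le_of_card_ge inf_le_right ?_)
    by_contra! hlt
    exact absurd h1 (Nat.mul_lt_mul_of_lt_of_le hlt hmap hpos').ne

theorem notMem_swap {x y : G} (hxy : y ∉ centralizerMod x) : x ∉ centralizerMod y :=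
  fun h => hxy (mem_centralizerMod_comm.1 h)

theorem exists_commutator_eq_right [Finite G] (h : IsClassThreeOfConjugateType G q) {x y g : G}
    (hxy : y ∉ centralizerMod x) :
    g ∈ centralCommutators y ↔ ∃ t ∈ centralizerMod y, ⁅⁅x, y⁆, t⁆ = g := by
  rw [← (h.map_centralizerMod_eq_and_centralizer_le hxy).1]; rfl

theorem exists_commutator_eq_left [Finite G] (h : IsClassThreeOfConjugateType G q) {x y g : G}
    (hxy : y ∉ centralizerMod x) :
    g ∈ centralCommutators x ↔ ∃ t ∈ centralizerMod x, ⁅⁅x, y⁆, t⁆ = g := by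
  have key : ∀ t, ⁅⁅y, x⁆, t⁻¹⁆ = ⁅⁅x, y⁆, t⁆ := fun t => by
    have h1 := commutatorElement_mem_center_left (h.commutator_mem x y) t
    have h2 := commutatorElement_mem_center_left (h.commutator_mem y x) t
    rw [commutatorElement_inv_right_of_mem_center h2, ← commutatorElement_inv x y,
      commutatorElement_inv_left_of_mem_center h1, inv_inv]
  rw [h.exists_commutator_eq_right (notMem_swap hxy)]
  constructor
  · rintro ⟨t, ht, rfl⟩; exact ⟨t⁻¹, inv_mem ht, by rw [← key, inv_inv]⟩
  · rintro ⟨t, ht, rfl⟩; exact ⟨t⁻¹, inv_mem ht, key t⟩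

theorem centralizer_commutator_le_right [Finite G] (h : IsClassThreeOfConjugateType G q) {x y : G}
    (hxy : y ∉ centralizerMod x) : centralizer {⁅x, y⁆} ≤ centralizerMod y :=
  (h.map_centralizerMod_eq_and_centralizer_le hxy).2

/-- Central commutators of a fixed `y` outside the second centre are already of the form `⁅y, g⁆`
with `g` a commutator. -/
theorem exists_commutator_of_mem_centralCommutators [Finite G]
    (h : IsClassThreeOfConjugateType G q) {y g : G} (hy : y ∉ secondCenter G)
    (hg : g ∈ centralCommutators y) : ∃ a b : G, ⁅y, ⁅a, b⁆⁆ = g := by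
  obtain ⟨x, hx⟩ := exists_notMem_centralizerMod hy
  obtain ⟨t, ht, rfl⟩ := (h.exists_commutator_eq_right (notMem_swap hx)).1 hg
  exact ⟨t, x, by rw [h.commutator_commutator_eq ht, commutatorElement_inv]⟩

/-- Both outer terms of the Hall–Witt identity for `x, y, v` are values of `f = ⁅⁅x, y⁆, ·⁆`, at `t
∈ C(y)` and `s ∈ C(x)`. The identity then puts `s⁻¹ * v * t` in `ker f`, which lies in `C(y)`. -/
theorem exists_mul_eq [Finite G] (h : IsClassThreeOfConjugateType G q) {x y : G}
    (hxy : y ∉ centralizerMod x) (v : G) :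
    ∃ a ∈ centralizerMod x, ∃ b ∈ centralizerMod y, a * b = v := by
  have hm : ∀ u w z : G, ⁅u, ⁅w, z⁆⁆ ∈ centralCommutators u := fun u w z =>
    mem_centralCommutators.2 ⟨_, secondCenter_le_centralizerMod u (h.commutator_mem w z), rfl⟩
  obtain ⟨t, ht, ht'⟩ := (h.exists_commutator_eq_right hxy).1 (hm y x v)
  obtain ⟨s, hs, hs'⟩ := (h.exists_commutator_eq_left hxy).1 (hm x y v)
  have hJ := h.jacobi x y v
  rw [← ht', ← hs'] at hJ
  have hc := h.commutator_mem x y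
  set f := secondCenterHom _ hc
  have hv : ⁅v, ⁅x, y⁆⁆ = (f v)⁻¹ := (commutatorElement_inv _ _).symm
  rw [hv] at hJ
  change f t = f s * (f v)⁻¹ at hJ
  have hcomm : ∀ a b, f a * f b = f b * f a := fun a b =>
    mem_center_iff.1 (commutatorElement_mem_center_left hc b) (f a)
  have hk : s⁻¹ * v * t ∈ f.ker := by
    rw [MonoidHom.mem_ker, map_mul, map_mul, map_inv, hJ, ← mul_assoc, mul_assoc (f s)⁻¹, hcomm v s]
    group
  rw [ker_secondCenterHom] at hk
  refine ⟨s, hs, s⁻¹ * v * t * t⁻¹, mul_mem (h.centralizer_commutator_le_right hxy hk)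
    (inv_mem ht), ?_⟩
  group

theorem mem_secondCenter_of_forall {z x y : G} (hz : ∀ v, ∃ a ∈ centralizerMod x,
    ∃ b ∈ centralizerMod y, a * b = v) (h1 : centralizerMod x ≤ centralizerMod z)
    (h2 : centralizerMod y ≤ centralizerMod z) : z ∈ secondCenter G := by
  refine mem_secondCenter.2 fun v => mem_centralizerMod_comm.1 ?_
  obtain ⟨a, ha, b, hb, rfl⟩ := hz v
  exact mul_mem (h1 ha) (h2 hb)

/-- For `b ∈ C(x)`, `⁅x, y * b⁆` and `⁅x, y⁆` differ by a central factor. So `z` centralizes both,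
hence commutes modulo `Z` with `y` and with `y * b`, and therefore with `b`. -/
theorem centralizerMod_right_le_of_commute [Finite G] (h : IsClassThreeOfConjugateType G q)
    {x y z : G} (hxy : y ∉ centralizerMod x) (hz : z ∈ centralizer {⁅x, y⁆}) :
    centralizerMod x ≤ centralizerMod z := by
  intro b hb
  have hyb : y * b ∉ centralizerMod x := fun hyb => hxy ((mul_mem_cancel_right hb).1 hyb)
  have hzb : z ∈ centralizer {⁅x, y * b⁆} := by
    rw [mem_centralizer_singleton_iff_commutatorElement] at hz ⊢
    rwa [commutatorElement_mul_right_of_mem_center y (mem_centralizerMod.1 hb),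
      commutatorElement_mul_center_left (mem_centralizerMod.1 hb)]
  have h1 := mem_centralizerMod_comm.1 (h.centralizer_commutator_le_right hxy hz)
  have h2 := mem_centralizerMod_comm.1 (h.centralizer_commutator_le_right hyb hzb)
  exact (mul_mem_cancel_left h1).1 h2

theorem mem_centralizer_commutator_swap {x y z : G} (hz : z ∈ centralizer {⁅x, y⁆}) :
    z ∈ centralizer {⁅y, x⁆} := by
  rw [mem_centralizer_singleton_iff] at hz ⊢
  rw [← commutatorElement_inv x y]
  exact (Commute.inv_right (show Commute z ⁅x, y⁆ from hz) : Commute z _)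

/-- The centralizer of a noncentral commutator is the second centre. -/
theorem centralizer_commutator_eq [Finite G] (h : IsClassThreeOfConjugateType G q) {x y : G}
    (hxy : y ∉ centralizerMod x) : centralizer {⁅x, y⁆} = secondCenter G := by
  refine le_antisymm (fun z hz => ?_) fun z hz => ?_
  · exact mem_secondCenter_of_forall (h.exists_mul_eq hxy)
      (h.centralizerMod_right_le_of_commute hxy hz)
      (h.centralizerMod_right_le_of_commute (notMem_swap hxy) (mem_centralizer_commutator_swap hz))
  · exact mem_centralizer_singleton_iff.2 (commutatorElement_mul_comm_of_mem_secondCenter hz x y)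

theorem inf_centralizerMod [Finite G] (h : IsClassThreeOfConjugateType G q) {x y : G}
    (hxy : y ∉ centralizerMod x) : centralizerMod x ⊓ centralizerMod y = secondCenter G := by
  refine le_antisymm ?_ (le_inf (secondCenter_le_centralizerMod x)
    (secondCenter_le_centralizerMod y))
  rintro z ⟨hzx, hzy⟩
  have key : ∀ x, x ∉ secondCenter G → z ∈ centralizerMod x →
      centralizerMod x ≤ centralizerMod z := by
    intro x hx hzx a ha
    by_contra hza
    refine hx ((h.centralizer_commutator_eq hza).le ?_)
    -- Two of the three terms vanish, so `x` centralizes the noncentral commutator `⁅z, a⁆`, whose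
    -- centralizer is `Z₂`.
    have hJ := h.jacobi z x a
    rw [commutatorElement_eq_one_of_mem_center_right (mem_centralizerMod.1 ha),
      commutatorElement_eq_one_of_mem_center_right
        (mem_centralizerMod.1 (mem_centralizerMod_comm.1 hzx)), one_mul] at hJ
    rw [mem_centralizer_singleton_iff, commutatorElement_eq_one_iff_mul_comm.1 hJ]
  exact mem_secondCenter_of_forall (h.exists_mul_eq hxy)
    (key x (notMem_secondCenter_of_notMem_centralizerMod hxy) hzx)
    (key y (notMem_secondCenter_of_notMem_centralizerMod (notMem_swap hxy)) hzy)

/-- Commuting modulo the centre is transitive outside the second centre. -/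
theorem mem_centralizerMod_trans [Finite G] (h : IsClassThreeOfConjugateType G q) {x a b : G}
    (hx : x ∉ secondCenter G) (ha : a ∈ centralizerMod x) (hb : b ∈ centralizerMod x) :
    b ∈ centralizerMod a := by
  by_contra hab
  exact hx ((h.inf_centralizerMod hab).le
    ⟨mem_centralizerMod_comm.1 ha, mem_centralizerMod_comm.1 hb⟩)

end IsClassThreeOfConjugateType

theorem exists_notMem_notMem {G : Type*} [Group G] {H K : Subgroup G} (hH : H ≠ ⊤) (hK : K ≠ ⊤) :
    ∃ w, w ∉ H ∧ w ∉ K := by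
  by_contra! hcon
  obtain ⟨a, -, ha⟩ := SetLike.exists_of_lt hH.lt_top
  obtain ⟨b, -, hb⟩ := SetLike.exists_of_lt hK.lt_top
  have haK := hcon a ha
  have hbH : b ∈ H := by_contra fun h => hb (hcon b h)
  have hab : a * b ∉ H := fun h => ha ((mul_mem_cancel_right hbH).1 h)
  exact hb ((mul_mem_cancel_left haK).1 (hcon _ hab))

/-! ### Orders of the characteristic pieces -/

namespace IsClassThreeOfConjugateType

variable {G : Type*} [Group G] {q : ℕ}

theorem normal_centralizerMod (h : IsClassThreeOfConjugateType G q) (x : G) :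
    (centralizerMod x).Normal := by
  refine ⟨fun z hz g => ?_⟩
  have : g * z * g⁻¹ = ⁅g, z⁆ * z := by rw [commutatorElement_def]; group
  rw [this]
  exact mul_mem (secondCenter_le_centralizerMod x (h.commutator_mem g z)) hz

theorem commutator_mem_centralCommutators {u : G} (hu : u ∈ secondCenter G) (x : G) :
    ⁅x, u⁆ ∈ centralCommutators x :=
  mem_centralCommutators.2 ⟨u, secondCenter_le_centralizerMod x hu, rfl⟩

theorem mul_secondCenter_notMem {x z : G} (hx : x ∉ secondCenter G) (hz : z ∈ secondCenter G) :
    x * z ∉ secondCenter G := fun hxz => hx ((mul_mem_cancel_right hz).1 hxz)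

theorem exists_notMem_secondCenter (h : IsClassThreeOfConjugateType G q) :
    ∃ x : G, x ∉ secondCenter G := by
  obtain ⟨x, y, hxy⟩ := h.exists_notMem
  exact ⟨x, notMem_secondCenter_of_notMem_centralizerMod hxy⟩

variable [Finite G]

theorem card_secondCenter (h : IsClassThreeOfConjugateType G q) :
    q ^ 2 * Nat.card (secondCenter G) = Nat.card G := by
  obtain ⟨x, y, hxy⟩ := h.exists_notMem
  rw [← h.centralizer_commutator_eq hxy]
  exact h.card_centralizer _ fun hc => hxy (mem_centralizerMod.2 hc)

theorem pos (h : IsClassThreeOfConjugateType G q) : 0 < q := by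
  refine Nat.pos_of_ne_zero fun h0 => ?_
  have := h.card_secondCenter
  rw [h0, zero_pow two_ne_zero, zero_mul] at this
  exact Nat.card_pos.ne this

theorem card_centralizerMod_mul (h : IsClassThreeOfConjugateType G q) {x y : G}
    (hxy : y ∉ centralizerMod x) : Nat.card (centralizerMod x) * Nat.card (centralizerMod y) =
      Nat.card G * Nat.card (secondCenter G) := by
  have := h.normal_centralizerMod y
  have hsup : centralizerMod x ⊔ centralizerMod y = ⊤ := by
    refine eq_top_iff.2 fun v _ => ?_
    obtain ⟨a, ha, b, hb, rfl⟩ := h.exists_mul_eq hxy v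
    exact mul_mem_sup ha hb
  have h1 := relIndex_sup_right (centralizerMod x) (centralizerMod y)
  rw [hsup, relIndex_top_right, ← inf_relIndex_left, h.inf_centralizerMod hxy] at h1
  have h2 := card_mul_index (centralizerMod y)
  have h3 := card_mul_index ((secondCenter G).subgroupOf (centralizerMod x))
  rw [Nat.card_congr (subgroupOfEquivOfLe (secondCenter_le_centralizerMod x)).toEquiv] at h3
  change _ * (secondCenter G).relIndex _ = _ at h3
  rw [← h2, ← h3, h1]
  ring

/-- The product `|C(x)| · |C(y)|` is the same for every pair not commuting modulo `Z`. A third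
element `w` outside `C(x)` and `C(y)` makes all three orders equal, so each is a square root of `|G|
· |Z₂| = (q|Z₂|)²`. -/
theorem card_centralizerMod (h : IsClassThreeOfConjugateType G q) {x : G}
    (hx : x ∉ secondCenter G) :
    Nat.card (centralizerMod x) = q * Nat.card (secondCenter G) := by
  have hne : ∀ {x y : G}, y ∉ centralizerMod x → centralizerMod x ≠ ⊤ := fun hxy ht =>
    hxy (ht ▸ mem_top _)
  obtain ⟨y, hxy⟩ := exists_notMem_centralizerMod hx
  obtain ⟨w, hxw, hyw⟩ := exists_notMem_notMem (hne hxy) (hne (notMem_swap hxy))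
  have h1 := h.card_centralizerMod_mul hxy
  have h2 := h.card_centralizerMod_mul hxw
  have h3 := h.card_centralizerMod_mul hyw
  have hw : Nat.card (centralizerMod y) = Nat.card (centralizerMod w) :=
    Nat.eq_of_mul_eq_mul_left Nat.card_pos (h1.trans h2.symm)
  have hx' : Nat.card (centralizerMod x) = Nat.card (centralizerMod y) :=
    Nat.eq_of_mul_eq_mul_right Nat.card_pos (h2.trans h3.symm)
  rw [← hx', ← h.card_secondCenter] at h1
  refine Nat.pow_left_injective (n := 2) two_ne_zero ?_
  simp only
  rw [pow_two, h1]
  ring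

theorem card_centralizer_eq_card_secondCenter (h : IsClassThreeOfConjugateType G q) {x : G}
    (hx : x ∉ center G) : Nat.card (centralizer {x}) = Nat.card (secondCenter G) :=
  Nat.eq_of_mul_eq_mul_left (pow_pos h.pos 2)
    ((h.card_centralizer x hx).trans h.card_secondCenter.symm)

theorem card_centralCommutators (h : IsClassThreeOfConjugateType G q) {x : G}
    (hx : x ∉ secondCenter G) : Nat.card (centralCommutators x) = q := by
  have h1 := card_mul_card_centralCommutators x
  rw [h.card_centralizerMod hx,
    h.card_centralizer_eq_card_secondCenter (fun hc => hx (center_le_secondCenter hc)),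
    mul_comm q] at h1
  exact Nat.eq_of_mul_eq_mul_left Nat.card_pos h1

/-- Write `g = f s = f t` with `s ∈ C(x)`, `t ∈ C(y)` and `f = ⁅⁅x, y⁆, ·⁆`. As `ker f = Z₂`, also
`t ∈ C(x)`, so `t ∈ C(x) ∩ C(y) = ker f`. -/
theorem eq_one_of_mem_centralCommutators (h : IsClassThreeOfConjugateType G q) {x y g : G}
    (hxy : y ∉ centralizerMod x) (hgx : g ∈ centralCommutators x)
    (hgy : g ∈ centralCommutators y) : g = 1 := by
  obtain ⟨s, hs, hs'⟩ := (h.exists_commutator_eq_left hxy).1 hgx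
  obtain ⟨t, ht, ht'⟩ := (h.exists_commutator_eq_right hxy).1 hgy
  set f := secondCenterHom _ (h.commutator_mem x y)
  change f s = g at hs'
  change f t = g at ht'
  have hker : f.ker = secondCenter G :=
    (ker_secondCenterHom _ _).trans (h.centralizer_commutator_eq hxy)
  have hst : s⁻¹ * t ∈ secondCenter G := by
    rw [← hker, MonoidHom.mem_ker, map_mul, map_inv, hs', ht', inv_mul_cancel]
  have hsy : t ∈ centralizerMod x := by
    rw [← mul_inv_cancel_left s t]
    exact mul_mem hs (secondCenter_le_centralizerMod x hst)
  rw [← ht', ← MonoidHom.mem_ker, hker, ← h.inf_centralizerMod hxy]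
  exact ⟨hsy, ht⟩

/-- Every element of `D(x * z)` has the form `⁅x * z, ⁅a, b⁆⁆`, and `z` commutes with `⁅a, b⁆`. -/
theorem centralCommutators_mul_le (h : IsClassThreeOfConjugateType G q) {x z : G}
    (hx : x ∉ secondCenter G) (hz : z ∈ secondCenter G) :
    centralCommutators (x * z) ≤ centralCommutators x := by
  intro g hg
  obtain ⟨a, b, rfl⟩ := h.exists_commutator_of_mem_centralCommutators
    (mul_secondCenter_notMem hx hz) hg
  have h1 : ⁅z, ⁅a, b⁆⁆ = 1 := commutatorElement_eq_one_iff_mul_comm.2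
    (commutatorElement_mul_comm_of_mem_secondCenter hz a b)
  rw [commutatorElement_mul_left_of_mem_center x (by rw [h1]; exact one_mem _), h1, mul_one]
  exact commutator_mem_centralCommutators (h.commutator_mem a b) x

theorem centralCommutators_mul (h : IsClassThreeOfConjugateType G q) {x z : G}
    (hx : x ∉ secondCenter G) (hz : z ∈ secondCenter G) :
    centralCommutators (x * z) = centralCommutators x := by
  refine le_antisymm (h.centralCommutators_mul_le hx hz) ?_
  have := h.centralCommutators_mul_le (mul_secondCenter_notMem hx hz) (inv_mem hz)
  rwa [mul_inv_cancel_right] at this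

/-- The second centre is abelian. -/
theorem secondCenter_commutator_eq_one (h : IsClassThreeOfConjugateType G q) {z u : G}
    (hz : z ∈ secondCenter G) (hu : u ∈ secondCenter G) : ⁅z, u⁆ = 1 := by
  -- Since `D(x * z) = D(x)` contains `⁅x * z, u⁆ = ⁅x, u⁆ * ⁅z, u⁆`, it contains `⁅z, u⁆`; two such
  -- subgroups meet trivially.
  have key : ∀ x, x ∉ secondCenter G → ⁅z, u⁆ ∈ centralCommutators x := fun x hx => by
    have h1 := commutator_mem_centralCommutators hu (x * z)
    rw [h.centralCommutators_mul hx hz, commutatorElement_mul_left_of_mem_center x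
      (commutatorElement_mem_center_left hz u)] at h1
    exact (mul_mem_cancel_left (commutator_mem_centralCommutators hu x)).1 h1
  obtain ⟨x, y, hxy⟩ := h.exists_notMem
  exact h.eq_one_of_mem_centralCommutators hxy
    (key x (notMem_secondCenter_of_notMem_centralizerMod hxy))
    (key y (notMem_secondCenter_of_notMem_centralizerMod (notMem_swap hxy)))

theorem centralizer_eq_secondCenter (h : IsClassThreeOfConjugateType G q) {u : G}
    (hu : u ∈ secondCenter G) (hu' : u ∉ center G) : centralizer {u} = secondCenter G :=
  (eq_of_le_of_card_ge (fun _ hz => mem_centralizer_singleton_iff_commutatorElement.2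
    (h.secondCenter_commutator_eq_one hu hz)) (h.card_centralizer_eq_card_secondCenter hu').le).symm

theorem mem_center_of_commutator_eq_one (h : IsClassThreeOfConjugateType G q) {x u : G}
    (hx : x ∉ secondCenter G) (hu : u ∈ secondCenter G) (hxu : ⁅x, u⁆ = 1) : u ∈ center G := by
  by_contra hu'
  refine hx ((h.centralizer_eq_secondCenter hu hu').le ?_)
  rw [mem_centralizer_singleton_iff, commutatorElement_eq_one_iff_mul_comm.1 hxu]

theorem exists_secondCenter_of_mem_centralCommutators (h : IsClassThreeOfConjugateType G q)
    {y g : G} (hy : y ∉ secondCenter G) (hg : g ∈ centralCommutators y) :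
    ∃ u ∈ secondCenter G, ⁅y, u⁆ = g := by
  obtain ⟨a, b, hab⟩ := h.exists_commutator_of_mem_centralCommutators hy hg
  exact ⟨_, h.commutator_mem a b, hab⟩

/-- On `Z₂` the map `u ↦ ⁅x, u⁆` has image `D(x)`, of order `q`, and kernel `Z`. -/
theorem card_secondCenter_eq (h : IsClassThreeOfConjugateType G q) :
    Nat.card (secondCenter G) = q * Nat.card (center G) := by
  obtain ⟨x, hx⟩ := h.exists_notMem_secondCenter
  have hle := secondCenter_le_centralizerMod x
  have hle' := center_le_secondCenter.trans hle
  have h1 := card_inf_ker_mul_card_map (commutatorHom x)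
    ((secondCenter G).subgroupOf (centralizerMod x))
  have h2 : ((secondCenter G).subgroupOf (centralizerMod x)).map (commutatorHom x) =
      centralCommutators x := by
    ext g
    constructor
    · rintro ⟨u, hu, rfl⟩; exact commutator_mem_centralCommutators hu x
    · intro hg
      obtain ⟨u, hu, rfl⟩ := h.exists_secondCenter_of_mem_centralCommutators hx hg
      exact ⟨⟨u, hle hu⟩, hu, rfl⟩
  have h3 : (secondCenter G).subgroupOf (centralizerMod x) ⊓ (commutatorHom x).ker =
      (center G).subgroupOf (centralizerMod x) := by
    ext u
    constructor
    · rintro ⟨hu, hu'⟩; exact h.mem_center_of_commutator_eq_one hx hu hu'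
    · intro hu
      exact ⟨center_le_secondCenter hu, commutatorElement_eq_one_of_mem_center_right hu x⟩
  rw [h2, h3, h.card_centralCommutators hx, Nat.card_congr (subgroupOfEquivOfLe hle).toEquiv,
    Nat.card_congr (subgroupOfEquivOfLe hle').toEquiv] at h1
  rw [← h1, mul_comm]

theorem card_eq (h : IsClassThreeOfConjugateType G q) :
    Nat.card G = q ^ 3 * Nat.card (center G) := by
  rw [← h.card_secondCenter, h.card_secondCenter_eq]; ring

/-- Commutators with a fixed element outside the second centre fill the second centre
modulo the centre. -/
theorem exists_commutator_eq_mul_center (h : IsClassThreeOfConjugateType G q) {x u : G}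
    (hx : x ∉ secondCenter G) (hu : u ∈ secondCenter G) :
    ∃ y, ∃ k ∈ center G, ⁅x, y⁆ = u * k := by
  let π := QuotientGroup.mk' (center G)
  let f : G →* G ⧸ center G := MonoidHom.mk' (fun y => π ⁅x, y⁆) fun y z => by
    rw [← map_mul, ← mul_inv_eq_one, ← map_inv, ← map_mul, QuotientGroup.mk'_apply,
      QuotientGroup.eq_one_iff]
    have : ⁅x, y * z⁆ * (⁅x, y⁆ * ⁅x, z⁆)⁻¹ = ⁅x, y⁆ * ⁅y, ⁅x, z⁆⁆ * ⁅x, y⁆⁻¹ := by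
      simp only [commutatorElement_def]; group
    rw [this]
    exact (inferInstance : (center G).Normal).conj_mem _ (h.commutator_mem_center y x z) _
  have hker : f.ker = centralizerMod x := by
    ext y
    rw [MonoidHom.mem_ker, mem_centralizerMod, ← QuotientGroup.eq_one_iff]
    rfl
  have hle : f.range ≤ (secondCenter G).map π := by
    rintro _ ⟨y, rfl⟩
    exact ⟨_, h.commutator_mem x y, rfl⟩
  have h1 := card_mul_index f.ker
  rw [index_ker, hker, h.card_centralizerMod hx, ← h.card_secondCenter] at h1
  have h2 := card_inf_ker_mul_card_map π (secondCenter G)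
  have h3 : secondCenter G ⊓ π.ker = center G := by
    rw [QuotientGroup.ker_mk']; exact inf_eq_right.2 center_le_secondCenter
  rw [h3, h.card_secondCenter_eq, mul_comm q] at h2
  have h4 : Nat.card ((secondCenter G).map π) = q := Nat.eq_of_mul_eq_mul_left Nat.card_pos h2
  have h5 : Nat.card f.range = q := by
    refine Nat.eq_of_mul_eq_mul_left (mul_pos h.pos (Nat.card_pos (α := secondCenter G))) ?_
    rw [h1]; ring
  -- The image has order `|G : C(x)| = q`, which is also the order of `Z₂ / Z`.
  have h6 : f.range = (secondCenter G).map π := eq_of_le_of_card_ge hle (by rw [h4, h5])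
  obtain ⟨y, hy⟩ : π u ∈ f.range := h6 ▸ ⟨u, hu, rfl⟩
  refine ⟨y, u⁻¹ * ⁅x, y⁆, ?_, (mul_inv_cancel_left _ _).symm⟩
  exact QuotientGroup.eq.1 hy.symm

/-- Modulo `Z`, `c` is a commutator `⁅x, y⁆`, and central factors do not affect `⁅c, t⁆`. -/
theorem mem_centralCommutators_iff (h : IsClassThreeOfConjugateType G q) {x c g : G}
    (hx : x ∉ secondCenter G) (hc : c ∈ secondCenter G) (hc' : c ∉ center G) :
    g ∈ centralCommutators x ↔ ∃ t ∈ centralizerMod x, ⁅c, t⁆ = g := by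
  obtain ⟨y, k, hk, hy⟩ := h.exists_commutator_eq_mul_center hx hc
  have hxy : y ∉ centralizerMod x := fun hxy => by
    rw [mem_centralizerMod, hy] at hxy
    exact hc' ((mul_mem_cancel_right hk).1 hxy)
  rw [h.exists_commutator_eq_left hxy]
  simp only [hy, commutatorElement_mul_center_left hk]

end IsClassThreeOfConjugateType

/-! ### The commutator subgroup and the solvable first entries -/

namespace IsClassThreeOfConjugateType

variable {G : Type*} [Group G] {q : ℕ}

theorem exists_mem_secondCenter_notMem_center (h : IsClassThreeOfConjugateType G q) :
    ∃ c ∈ secondCenter G, c ∉ center G := by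
  obtain ⟨x, y, hxy⟩ := h.exists_notMem
  exact ⟨_, h.commutator_mem x y, fun hc => hxy (mem_centralizerMod.2 hc)⟩

theorem range_le_center {c : G} (hc : c ∈ secondCenter G) :
    (secondCenterHom c hc).range ≤ center G := by
  rintro _ ⟨z, rfl⟩
  exact commutatorElement_mem_center_left hc z

variable [Finite G]

theorem mem_range_of_mem_centralCommutators (h : IsClassThreeOfConjugateType G q) {x c g : G}
    (hx : x ∉ secondCenter G) (hc : c ∈ secondCenter G) (hc' : c ∉ center G)
    (hg : g ∈ centralCommutators x) : g ∈ (secondCenterHom c hc).range := by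
  obtain ⟨t, -, ht⟩ := (h.mem_centralCommutators_iff hx hc hc').1 hg
  exact ⟨t, ht⟩

/-- Applied to two choices of `c`, this shows that the range `W` is the same for every noncentral `c
∈ Z₂`. -/
theorem commutator_mem_range (h : IsClassThreeOfConjugateType G q) {c u : G}
    (hc : c ∈ secondCenter G) (hc' : c ∉ center G) (hu : u ∈ secondCenter G) (v : G) :
    ⁅u, v⁆ ∈ (secondCenterHom c hc).range := by
  by_cases hv : v ∈ secondCenter G
  · rw [h.secondCenter_commutator_eq_one hu hv]; exact one_mem _
  · rw [← commutatorElement_inv]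
    exact inv_mem (h.mem_range_of_mem_centralCommutators hv hc hc'
      (commutator_mem_centralCommutators hu v))

theorem central_commutator_mem_range (h : IsClassThreeOfConjugateType G q) {c a b : G}
    (hc : c ∈ secondCenter G) (hc' : c ∉ center G) (hab : ⁅a, b⁆ ∈ center G) :
    ⁅a, b⁆ ∈ (secondCenterHom c hc).range := by
  by_cases ha : a ∈ secondCenter G
  · exact h.commutator_mem_range hc hc' ha b
  · exact h.mem_range_of_mem_centralCommutators ha hc hc'
      (mem_centralCommutators.2 ⟨b, mem_centralizerMod.2 hab, rfl⟩)

/-- Modulo the third term of the lower central series, every element of the commutator subgroup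
is a commutator with any prescribed first entry outside the second centre. -/
theorem exists_commutator_mul_eq (h : IsClassThreeOfConjugateType G q) {c x g : G}
    (hc : c ∈ secondCenter G) (hc' : c ∉ center G) (hx : x ∉ secondCenter G)
    (hg : g ∈ commutator G) :
    ∃ y, ∃ w ∈ (secondCenterHom c hc).range, g = ⁅x, y⁆ * w := by
  set W := (secondCenterHom c hc).range with hW
  have hWn : W.Normal := ⟨fun w hw g => by
    rwa [mem_center_iff.1 (range_le_center hc hw) g, mul_inv_cancel_right]⟩
  let π := QuotientGroup.mk' W
  have hone : ∀ {w : G}, w ∈ W → π w = 1 := fun hw => (QuotientGroup.eq_one_iff _).2 hw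
  have hcen : ∀ a b : G, ⁅π a, π b⁆ ∈ center (G ⧸ W) := fun a b => by
    refine mem_center_iff.2 fun v => ?_
    obtain ⟨v, rfl⟩ := QuotientGroup.mk'_surjective W v
    refine (commutatorElement_eq_one_iff_mul_comm.1 ?_).symm
    change ⁅⁅π a, π b⁆, π v⁆ = 1
    rw [← map_commutatorElement, ← map_commutatorElement]
    exact hone (h.commutator_mem_range hc hc' (h.commutator_mem a b) v)
  have htriv : ∀ {a b : G}, b ∈ centralizerMod a → ⁅π a, π b⁆ = 1 := fun {a b} hab => by
    rw [← map_commutatorElement]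
    exact hone (h.central_commutator_mem_range hc hc' (mem_centralizerMod.1 hab))
  have hmr : ∀ a b v : G, ⁅π a, π (b * v)⁆ = ⁅π a, π b⁆ * ⁅π a, π v⁆ := fun a b v => by
    rw [map_mul, commutatorElement_mul_right_of_mem_center _ (hcen a v)]
  have hml : ∀ a b v : G, ⁅π (a * b), π v⁆ = ⁅π a, π v⁆ * ⁅π b, π v⁆ := fun a b v => by
    rw [map_mul, commutatorElement_mul_left_of_mem_center _ (hcen b v)]
  -- Modulo `W`, elements commuting modulo `Z` commute. Write `v = a' * b` and `a = s * t` with `a'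
  -- ∈ C(x)`, `b, t ∈ C(y)`, `s ∈ C(x * b)`. Expanding `⁅x * b, a * t⁻¹⁆ ≡ 1` leaves `⁅x, t⁻¹⁆ * ⁅b,
  -- a⁆ ≡ 1`, so `⁅a, v⁆ ≡ ⁅a, b⁆ ≡ ⁅x, t⁻¹⁆`.
  have hsame : ∀ a ∈ centralizerMod x, ∀ v, ∃ w, ⁅π a, π v⁆ = ⁅π x, π w⁆ := by
    intro a ha v
    obtain ⟨y, hxy⟩ := exists_notMem_centralizerMod hx
    obtain ⟨a', ha', b, hb, rfl⟩ := h.exists_mul_eq hxy v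
    have hxb : y ∉ centralizerMod (x * b) := fun hxb => hxy (mem_centralizerMod_comm.1
      ((mul_mem_cancel_right hb).1 (mem_centralizerMod_comm.1 hxb)))
    obtain ⟨s, hs, t, ht, hst⟩ := h.exists_mul_eq hxb a
    have hy : y ∉ secondCenter G := notMem_secondCenter_of_notMem_centralizerMod (notMem_swap hxy)
    have h1 := htriv hs
    rw [eq_mul_inv_of_mul_eq hst, hml, hmr, hmr, htriv ha, one_mul,
      htriv (h.mem_centralizerMod_trans hy hb (inv_mem ht)), mul_one] at h1
    refine ⟨t⁻¹, ?_⟩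
    rw [hmr, htriv (h.mem_centralizerMod_trans hx ha ha'), one_mul, eq_inv_of_mul_eq_one_left h1,
      commutatorElement_inv]
  have hall : ∀ a v, ⁅π a, π v⁆ ∈ centralCommutators (π x) := by
    have hmem : ∀ w, ⁅π x, π w⁆ ∈ centralCommutators (π x) := fun w =>
      mem_centralCommutators.2 ⟨_, mem_centralizerMod.2 (hcen x w), rfl⟩
    intro a v
    by_cases hax : a ∈ centralizerMod x
    · obtain ⟨w, hw⟩ := hsame a hax v
      rw [hw]; exact hmem w
    · obtain ⟨s, hs, t, ht, rfl⟩ := h.exists_mul_eq (notMem_swap hax) v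
      obtain ⟨w, hw⟩ := hsame t ht a
      rw [hmr, htriv hs, one_mul, ← commutatorElement_inv, hw]
      exact inv_mem (hmem w)
  have hle : commutator G ≤ (centralCommutators (π x)).comap π := by
    rw [commutator_def, Subgroup.commutator_le]
    intro a _ v _
    rw [mem_comap, map_commutatorElement]
    exact hall a v
  obtain ⟨y, -, hy⟩ := mem_centralCommutators.1 (hle hg)
  obtain ⟨y, rfl⟩ := QuotientGroup.mk'_surjective W y
  refine ⟨y, ⁅x, y⁆⁻¹ * g, ?_, (mul_inv_cancel_left _ _).symm⟩
  change ⁅π x, π y⁆ = π g at hy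
  rw [← map_commutatorElement] at hy
  exact QuotientGroup.eq.1 hy

/-- The elements `x` that satisfy `⁅x, y⁆ = g` for some `y`, when `g` is central. -/
theorem setOf_exists_commutator_eq (h : IsClassThreeOfConjugateType G q) {g : G}
    (hg : g ∈ commutator G) (hg1 : g ≠ 1) (hgc : g ∈ center G) :
    ∃ t, t ∉ secondCenter G ∧
      {x | ∃ y, ⁅x, y⁆ = g} = (centralizerMod t : Set G) \ (center G : Set G) := by
  obtain ⟨c, hc, hc'⟩ := h.exists_mem_secondCenter_notMem_center
  obtain ⟨x, hx⟩ := h.exists_notMem_secondCenter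
  -- In `g = ⁅x, y⁆ * w` the commutator is itself central, hence in `W`.
  obtain ⟨t, rfl⟩ : g ∈ (secondCenterHom c hc).range := by
    obtain ⟨y, w, hw, rfl⟩ := h.exists_commutator_mul_eq hc hc' hx hg
    exact mul_mem (h.central_commutator_mem_range hc hc'
      ((mul_mem_cancel_right (range_le_center hc hw)).1 hgc)) hw
  change ⁅c, t⁆ ≠ 1 at hg1
  change ⁅c, t⁆ ∈ center G at hgc
  refine ⟨t, fun ht => hg1 (h.secondCenter_commutator_eq_one hc ht), ?_⟩
  ext x
  change (∃ y, ⁅x, y⁆ = ⁅c, t⁆) ↔ x ∈ centralizerMod t ∧ x ∉ center G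
  constructor
  · rintro ⟨y, hy⟩
    refine ⟨?_, fun hxc => hg1 (hy ▸ commutatorElement_eq_one_of_mem_center_left hxc y)⟩
    by_cases hx : x ∈ secondCenter G
    · exact secondCenter_le_centralizerMod t hx
    · have hmem : ⁅c, t⁆ ∈ centralCommutators x :=
        mem_centralCommutators.2 ⟨y, mem_centralizerMod.2 (hy ▸ hgc), hy⟩
      obtain ⟨s, hs, hst⟩ := (h.mem_centralCommutators_iff hx hc hc').1 hmem
      have hker : s⁻¹ * t ∈ (secondCenterHom c hc).ker := by
        rw [MonoidHom.mem_ker, map_mul, map_inv]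
        exact inv_mul_eq_one.2 hst
      rw [ker_secondCenterHom, h.centralizer_eq_secondCenter hc hc'] at hker
      rw [mem_centralizerMod_comm, ← mul_inv_cancel_left s t]
      exact mul_mem hs (secondCenter_le_centralizerMod x hker)
  · rintro ⟨hxt, hxc⟩
    by_cases hx : x ∈ secondCenter G
    · exact h.commutator_mem_range hx hxc hc t
    · obtain ⟨z, -, hz⟩ := mem_centralCommutators.1 ((h.mem_centralCommutators_iff hx hc hc').2
        ⟨t, mem_centralizerMod_comm.1 hxt, rfl⟩)
      exact ⟨z, hz⟩

/-- For noncentral `g`, the elements of a coset of the second centre that satisfy `⁅x, y⁆ = g` for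
some `y` form a coset of the centre. -/
theorem exists_setOf_mul_eq_image (h : IsClassThreeOfConjugateType G q) {g x : G}
    (hg : g ∈ commutator G) (hgc : g ∉ center G) (hx : x ∉ secondCenter G) :
    ∃ z₀, {z | z ∈ secondCenter G ∧ ∃ y, ⁅x * z, y⁆ = g} = (z₀ * ·) '' (center G : Set G) := by
  obtain ⟨c, hc, hc'⟩ := h.exists_mem_secondCenter_notMem_center
  obtain ⟨y, w, hw, rfl⟩ := h.exists_commutator_mul_eq hc hc' hx hg
  have hd' : ⁅x, y⁆ ∉ center G := fun hd =>
    hgc ((mul_mem_cancel_right (range_le_center hc hw)).2 hd)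
  have hd := h.commutator_mem x y
  have hxy : y ∉ centralizerMod x := fun hxy => hd' (mem_centralizerMod.1 hxy)
  have hy : y ∉ secondCenter G := notMem_secondCenter_of_notMem_centralizerMod (notMem_swap hxy)
  -- `W` is also the range for `⁅x, y⁆`, and `G = C(x)C(y)` splits it as `D(x)D(y)`.
  obtain ⟨α, hα, β, hβ, rfl⟩ : ∃ α ∈ centralCommutators x, ∃ β ∈ centralCommutators y,
      α * β = w := by
    obtain ⟨v, rfl⟩ := hw
    obtain ⟨v, hv⟩ := h.commutator_mem_range hd hd' hc v
    obtain ⟨a, ha, b, hb, rfl⟩ := h.exists_mul_eq hxy v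
    refine ⟨_, (h.exists_commutator_eq_left hxy).2 ⟨a, ha, rfl⟩, _,
      (h.exists_commutator_eq_right hxy).2 ⟨b, hb, rfl⟩, ?_⟩
    rw [map_mul] at hv
    exact hv
  obtain ⟨z₀, hz₀, hz₀y⟩ := h.exists_secondCenter_of_mem_centralCommutators hy (inv_mem hβ)
  have hz₀β : ⁅z₀, y⁆ = β := by rw [← commutatorElement_inv, hz₀y, inv_inv]
  have hβc : β ∈ center G := hz₀β ▸ commutatorElement_mem_center_left hz₀ y
  have hleft : ∀ {z}, z ∈ secondCenter G → ∀ v, ⁅x * z, v⁆ = ⁅x, v⁆ * ⁅z, v⁆ := fun hz v =>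
    commutatorElement_mul_left_of_mem_center x (commutatorElement_mem_center_left hz v)
  refine ⟨z₀, Set.ext fun z => ⟨?_, ?_⟩⟩
  · rintro ⟨hz, y', hy'⟩
    refine ⟨z₀⁻¹ * z, ?_, mul_inv_cancel_left _ _⟩
    obtain ⟨k, rfl⟩ : ∃ k, y' = y * k := ⟨y⁻¹ * y', (mul_inv_cancel_left _ _).symm⟩
    have hk : k ∈ centralizerMod x := by
      rw [mem_centralizerMod]
      have hzc := commutatorElement_mem_center_left hz (y * k)
      rw [hleft hz] at hy'
      have h1 : y * ⁅x, k⁆ * y⁻¹ = (α * β) * ⁅z, y * k⁆⁻¹ := by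
        have h2 : ⁅x, y * k⁆ = ⁅x, y⁆ * (y * ⁅x, k⁆ * y⁻¹) := by
          simp only [commutatorElement_def]; group
        rw [h2, mul_assoc] at hy'
        exact eq_mul_inv_of_mul_eq (mul_left_cancel hy')
      have h3 : y * ⁅x, k⁆ * y⁻¹ ∈ center G :=
        h1 ▸ mul_mem (range_le_center hc hw) (inv_mem hzc)
      have h4 := (inferInstance : (center G).Normal).conj_mem _ h3 y⁻¹
      have h5 : y⁻¹ * (y * ⁅x, k⁆ * y⁻¹) * y⁻¹⁻¹ = ⁅x, k⁆ := by group
      rwa [h5] at h4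
    have hkz : k ∈ centralizerMod (x * z) := mem_centralizerMod_comm.1
      (mul_mem (mem_centralizerMod_comm.1 hk) (secondCenter_le_centralizerMod k hz))
    have hγ : ⁅x * z, k⁆ ∈ centralCommutators x := by
      rw [← h.centralCommutators_mul hx hz]
      exact mem_centralCommutators.2 ⟨k, hkz, rfl⟩
    rw [commutatorElement_mul_right_of_mem_center y (mem_centralizerMod.1 hkz), hleft hz,
      mul_assoc] at hy'
    have h1 := mul_left_cancel hy'
    have h2 : ⁅z, y⁆ * β⁻¹ = α * ⁅x * z, k⁆⁻¹ := by
      rw [mul_inv_eq_iff_eq_mul, mul_assoc, mem_center_iff.1 hβc, ← mul_assoc]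
      exact eq_mul_inv_of_mul_eq h1
    have hzy : ⁅z, y⁆ ∈ centralCommutators y := by
      rw [← commutatorElement_inv]
      exact inv_mem (commutator_mem_centralCommutators hz y)
    -- This element lies in `D(x) ∩ D(y) = 1`, so `⁅z, y⁆ = β = ⁅z₀, y⁆`, which fixes `z` modulo
    -- `Z`.
    have h3 : ⁅z, y⁆ * β⁻¹ = 1 := h.eq_one_of_mem_centralCommutators hxy
      (h2 ▸ mul_mem hα (inv_mem hγ)) (mul_mem hzy (inv_mem hβ))
    refine h.mem_center_of_commutator_eq_one hy (mul_mem (inv_mem hz₀) hz) ?_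
    rw [commutatorElement_mul_right_of_mem_center _ (commutatorElement_mem_center_right hz y),
      commutatorElement_inv_right_of_mem_center (commutatorElement_mem_center_right hz₀ y),
      hz₀y, inv_inv, ← commutatorElement_inv z y, mul_inv_eq_one.1 h3, mul_inv_cancel]
  · rintro ⟨k, hk, rfl⟩
    have hz : z₀ * k ∈ secondCenter G := mul_mem hz₀ (center_le_secondCenter hk)
    refine ⟨hz, ?_⟩
    rw [← h.centralCommutators_mul hx hz] at hα
    obtain ⟨t, ht, rfl⟩ := mem_centralCommutators.1 hα
    refine ⟨y * t, ?_⟩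
    dsimp only
    rw [commutatorElement_mul_right_of_mem_center y (mem_centralizerMod.1 ht), hleft hz,
      commutatorElement_mul_center_left hk, hz₀β, mul_assoc,
      ← mem_center_iff.1 hβc]

end IsClassThreeOfConjugateType

end Structure

/-! ### Counting commutator pairs -/

section Counting

open Subgroup
open scoped commutatorElement

theorem ncard_setOf_fst_mem_snd_mem {α β : Type*} [Finite α] [Finite β] (A : Set α)
    (B : α → Set β) (k : ℕ) (hB : ∀ a ∈ A, (B a).ncard = k) :
    {p : α × β | p.1 ∈ A ∧ p.2 ∈ B p.1}.ncard = A.ncard * k := by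
  classical
  have := Fintype.ofFinite A
  let e : {p : α × β | p.1 ∈ A ∧ p.2 ∈ B p.1} ≃ Σ a : A, B a :=
    { toFun := fun p => ⟨⟨p.1.1, p.2.1⟩, ⟨p.1.2, p.2.2⟩⟩
      invFun := fun s => ⟨(s.1.1, s.2.1), s.1.2, s.2.2⟩
      left_inv := fun _ => rfl
      right_inv := fun _ => rfl }
  rw [← Nat.card_coe_set_eq, Nat.card_congr e, Nat.card_sigma]
  have hk : ∀ a : A, Nat.card (B a) = k := fun a => by
    rw [Nat.card_coe_set_eq]; exact hB a a.2
  simp only [hk, Finset.sum_const, Finset.card_univ, smul_eq_mul, ← Nat.card_eq_fintype_card,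
    Nat.card_coe_set_eq]

variable {G : Type*} [Group G]

theorem ncard_setOf_commutatorElement_eq {x g : G} (hx : ∃ y, ⁅x, y⁆ = g) :
    {y | ⁅x, y⁆ = g}.ncard = Nat.card (centralizer {x}) := by
  obtain ⟨y₀, rfl⟩ := hx
  have : {y | ⁅x, y⁆ = ⁅x, y₀⁆} = (y₀ * ·) '' (centralizer {x} : Set G) := by
    ext y
    rw [Set.image_mul_left, Set.mem_preimage, SetLike.mem_coe,
      mem_centralizer_singleton_iff_commutatorElement, Set.mem_ofPred_eq]
    have h1 : ⁅x, y₀⁻¹ * y⁆ = ⁅x, y₀⁻¹⁆ * (y₀⁻¹ * ⁅x, y⁆ * y₀) := by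
      simp only [commutatorElement_def]; group
    have h2 : ⁅x, y₀⁻¹⁆ = y₀⁻¹ * ⁅x, y₀⁆⁻¹ * y₀ := by
      simp only [commutatorElement_def]; group
    have h3 : ⁅x, y₀⁻¹ * y⁆ = y₀⁻¹ * (⁅x, y₀⁆⁻¹ * ⁅x, y⁆) * y₀ := by
      rw [h1, h2]; group
    rw [h3, mul_eq_one_iff_eq_inv, mul_eq_left, inv_mul_eq_one, eq_comm]
  rw [this, Set.ncard_image_of_injective _ (mul_right_injective y₀), ← Nat.card_coe_set_eq]
  rfl

theorem card_commFiber [Finite G] (g : G) :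
    Nat.card (commFiber g) = {p : G × G | ⁅p.1, p.2⁆ = g}.ncard := by
  rw [← Nat.card_coe_set_eq]
  -- Inverting both entries exchanges the two commutator conventions.
  refine Nat.card_congr (Equiv.subtypeEquiv (Equiv.inv (G × G)) fun p => ?_)
  simp [commFiber, groupComm, commutatorElement_def]

namespace IsClassThreeOfConjugateType

variable {q : ℕ} [Finite G]

theorem ncard_setOf_exists_commutator_eq (h : IsClassThreeOfConjugateType G q) {g : G}
    (hg : g ∈ commutator G) (hg1 : g ≠ 1) :
    {x : G | ∃ y, ⁅x, y⁆ = g}.ncard + Nat.card (center G) = q ^ 2 * Nat.card (center G) := by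
  have hcard : ∀ H : Subgroup G, (H : Set G).ncard = Nat.card H := fun H =>
    (Nat.card_coe_set_eq _).symm
  by_cases hgc : g ∈ center G
  · obtain ⟨t, ht, hS⟩ := h.setOf_exists_commutator_eq hg hg1 hgc
    have hle : (center G : Set G) ⊆ centralizerMod t :=
      center_le_secondCenter.trans (secondCenter_le_centralizerMod t)
    rw [hS, ← hcard, Set.ncard_sdiff_add_ncard_of_subset hle, hcard, hcard,
      h.card_centralizerMod ht, h.card_secondCenter_eq]
    ring
  · set S : Set G := {x | ∃ y, ⁅x, y⁆ = g} with hS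
    have hSn : ∀ x ∈ S, x ∉ secondCenter G := by
      rintro x ⟨y, rfl⟩ hx
      exact hgc (commutatorElement_mem_center_left hx y)
    have h1 := ncard_setOf_fst_mem_snd_mem (secondCenter G : Set G)ᶜ
      (fun x => {z | z ∈ secondCenter G ∧ ∃ y, ⁅x * z, y⁆ = g}) (Nat.card (center G))
      fun x hx => by
        obtain ⟨z₀, hz₀⟩ := h.exists_setOf_mul_eq_image hg hgc hx
        rw [hz₀, Set.ncard_image_of_injective _ (mul_right_injective z₀), hcard]
    have h2 := ncard_setOf_fst_mem_snd_mem S (fun _ => (secondCenter G : Set G))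
      (Nat.card (secondCenter G)) fun _ _ => hcard _
    -- Double count: `(x, z) ↦ (x * z, z)` matches the pairs with `x ∉ Z₂`, `z ∈ Z₂`, `x * z ∈ S`
    -- with `S × Z₂`, as `S` avoids `Z₂`.
    have h3 : {p : G × G | p.1 ∈ (secondCenter G : Set G)ᶜ ∧
        p.2 ∈ {z | z ∈ secondCenter G ∧ ∃ y, ⁅p.1 * z, y⁆ = g}}.ncard =
        {p : G × G | p.1 ∈ S ∧ p.2 ∈ (secondCenter G : Set G)}.ncard := by
      let e : G × G ≃ G × G :=
        { toFun := fun p => (p.1 * p.2, p.2)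
          invFun := fun p => (p.1 * p.2⁻¹, p.2)
          left_inv := fun p => by simp
          right_inv := fun p => by simp }
      rw [← Nat.card_coe_set_eq, ← Nat.card_coe_set_eq]
      refine Nat.card_congr (Equiv.subtypeEquiv e fun p => ⟨fun hp => ⟨hp.2.2, hp.2.1⟩, ?_⟩)
      rintro ⟨hp, hp'⟩
      exact ⟨fun hp1 => hSn _ hp (mul_mem hp1 hp'), hp', hp⟩
    have h4 := Set.ncard_add_ncard_compl (secondCenter G : Set G)
    rw [hcard, ← h.card_secondCenter] at h4
    have h5 := h3.symm.trans h1
    rw [h2] at h5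
    have hpos : 0 < Nat.card (secondCenter G) := Nat.card_pos
    refine Nat.eq_of_mul_eq_mul_right hpos ?_
    rw [add_mul, h5, mul_comm (Nat.card (center G)), ← add_mul, add_comm, h4]
    ring

theorem card_commFiber_of_ne_one (h : IsClassThreeOfConjugateType G q) {g : G}
    (hg : g ∈ commutator G) (hg1 : g ≠ 1) :
    (Nat.card (commFiber g) : ℚ) = ((q : ℚ) ^ 2 - 1) * q * Nat.card (center G) ^ 2 := by
  have h1 := ncard_setOf_fst_mem_snd_mem {x : G | ∃ y, ⁅x, y⁆ = g} (fun x => {y | ⁅x, y⁆ = g})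
    (Nat.card (secondCenter G)) fun x hx => by
      rw [ncard_setOf_commutatorElement_eq hx]
      refine h.card_centralizer_eq_card_secondCenter fun hxc => hg1 ?_
      obtain ⟨y, rfl⟩ := hx
      exact commutatorElement_eq_one_of_mem_center_left hxc y
  have h2 : {p : G × G | p.1 ∈ {x : G | ∃ y, ⁅x, y⁆ = g} ∧ p.2 ∈ {y | ⁅p.1, y⁆ = g}} =
      {p : G × G | ⁅p.1, p.2⁆ = g} := by
    ext p
    exact ⟨fun hp => hp.2, fun hp => ⟨⟨_, hp⟩, hp⟩⟩
  have h3 := h.ncard_setOf_exists_commutator_eq hg hg1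
  rw [card_commFiber, ← h2, h1, h.card_secondCenter_eq]
  have h4 : (({x : G | ∃ y, ⁅x, y⁆ = g}.ncard : ℕ) : ℚ) =
      ((q : ℚ) ^ 2 - 1) * Nat.card (center G) := by
    have : (({x : G | ∃ y, ⁅x, y⁆ = g}.ncard : ℕ) : ℚ) + Nat.card (center G) =
      (q : ℚ) ^ 2 * Nat.card (center G) := by exact_mod_cast h3
    linarith
  push_cast
  rw [h4]
  ring

theorem card_commFiber_one (h : IsClassThreeOfConjugateType G q) :
    (Nat.card (commFiber (1 : G)) : ℚ) =
      ((q : ℚ) ^ 3 + q ^ 2 - 1) * q * Nat.card (center G) ^ 2 := by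
  have h1 := ncard_setOf_fst_mem_snd_mem (center G : Set G)ᶜ (fun x => {y : G | ⁅x, y⁆ = 1})
    (Nat.card (secondCenter G)) fun x hx => by
      rw [ncard_setOf_commutatorElement_eq ⟨1, by simp⟩]
      exact h.card_centralizer_eq_card_secondCenter hx
  have h2 := ncard_setOf_fst_mem_snd_mem (center G : Set G) (fun x => {y : G | ⁅x, y⁆ = 1})
    (Nat.card G) fun x hx => by
      have : {y : G | ⁅x, y⁆ = 1} = Set.univ :=
        Set.eq_univ_of_forall fun y => commutatorElement_eq_one_of_mem_center_left hx y
      rw [this, Set.ncard_univ]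
  have h3 : {p : G × G | ⁅p.1, p.2⁆ = 1} =
      {p : G × G | p.1 ∈ (center G : Set G) ∧ p.2 ∈ {y | ⁅p.1, y⁆ = 1}} ∪
      {p : G × G | p.1 ∈ (center G : Set G)ᶜ ∧ p.2 ∈ {y | ⁅p.1, y⁆ = 1}} := by
    ext p
    simp only [Set.mem_ofPred_eq, Set.mem_union, Set.mem_compl_iff]
    tauto
  have hdisj : Disjoint {p : G × G | p.1 ∈ (center G : Set G) ∧ p.2 ∈ {y | ⁅p.1, y⁆ = 1}}
      {p : G × G | p.1 ∈ (center G : Set G)ᶜ ∧ p.2 ∈ {y | ⁅p.1, y⁆ = 1}} :=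
    Set.disjoint_left.2 fun p hp hp' => hp'.1 hp.1
  have h4 := Set.ncard_add_ncard_compl (center G : Set G)
  have h5 : (center G : Set G).ncard = Nat.card (center G) := (Nat.card_coe_set_eq _).symm
  rw [h.card_eq, h5] at h4
  rw [card_commFiber, h3, Set.ncard_union_eq hdisj, h1, h2, h5, h.card_secondCenter_eq, h.card_eq]
  have h6 : (((center G : Set G)ᶜ.ncard : ℕ) : ℚ) = ((q : ℚ) ^ 3 - 1) * Nat.card (center G) := by
    have : (Nat.card (center G) : ℚ) + ((center G : Set G)ᶜ.ncard : ℕ) =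
      (q : ℚ) ^ 3 * Nat.card (center G) := by exact_mod_cast h4
    linarith
  push_cast
  rw [h6]
  ring

theorem commPr_one (h : IsClassThreeOfConjugateType G q) :
    commPr (1 : G) = ((q : ℚ) ^ 3 + q ^ 2 - 1) / (q : ℚ) ^ 5 := by
  have hq : (q : ℚ) ≠ 0 := by exact_mod_cast h.pos.ne'
  have hz : (Nat.card (center G) : ℚ) ≠ 0 := by exact_mod_cast Nat.card_pos.ne'
  rw [commPr, h.card_commFiber_one, h.card_eq]
  push_cast
  field_simp

theorem commPr_of_ne_one (h : IsClassThreeOfConjugateType G q) {g : G}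
    (hg : g ∈ commutator G) (hg1 : g ≠ 1) : commPr g = ((q : ℚ) ^ 2 - 1) / (q : ℚ) ^ 5 := by
  have hq : (q : ℚ) ≠ 0 := by exact_mod_cast h.pos.ne'
  have hz : (Nat.card (center G) : ℚ) ≠ 0 := by exact_mod_cast Nat.card_pos.ne'
  rw [commPr, h.card_commFiber_of_ne_one hg hg1, h.card_eq]
  push_cast
  field_simp

end IsClassThreeOfConjugateType

/-! ### From class and conjugate type to the structural hypotheses -/

theorem groupComm_eq_commutatorElement_inv (x y : G) : groupComm x y = ⁅x⁻¹, y⁻¹⁆ := by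
  simp [groupComm, commutatorElement_def]

theorem card_conjugatesOf_mul_card_centralizer (x : G) :
    Nat.card (conjugatesOf x) * Nat.card (centralizer {x}) = Nat.card G := by
  have h1 : conjugatesOf x = MulAction.orbit (ConjAct G) x := by
    ext y
    rw [ConjAct.mem_orbit_conjAct, isConj_comm]
    rfl
  have h2 := MulAction.index_stabilizer (ConjAct G) x
  have h3 := card_mul_index (MulAction.stabilizer (ConjAct G) x)
  rw [h2, ConjAct.stabilizer_eq_centralizer, ← h1, ← Nat.card_coe_set_eq, mul_comm] at h3
  exact h3

theorem mem_secondCenter_iff_mem_upperCentralSeries {x : G} :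
    x ∈ secondCenter G ↔ x ∈ Subgroup.upperCentralSeries G 2 := by
  rw [Subgroup.mem_upperCentralSeries_succ_iff, mem_secondCenter]
  simp only [mem_centralizerMod_comm (z := x), mem_centralizerMod, Subgroup.upperCentralSeries_one,
    commutatorElement_def]

theorem isClassThreeOfConjugateType_of_nilpotencyClass [Finite G] [Group.IsNilpotent G] {q : ℕ}
    (hclass : Group.nilpotencyClass G = 3) (htype : IsConjugateType G (q ^ 2)) :
    IsClassThreeOfConjugateType G q where
  commutator_mem x y := by
    have h3 : Subgroup.upperCentralSeries G 3 = ⊤ := hclass ▸ Subgroup.upperCentralSeries_nilpotencyClass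
    have hx : x ∈ Subgroup.upperCentralSeries G 3 := h3 ▸ mem_top x
    exact mem_secondCenter_iff_mem_upperCentralSeries.2 (Subgroup.mem_upperCentralSeries_succ_iff.1 hx y)
  card_centralizer x hx := by
    rw [← htype.2 x hx, card_conjugatesOf_mul_card_centralizer]
  exists_notMem := by
    by_contra! hcon
    have h2 : Subgroup.upperCentralSeries G 2 = ⊤ := eq_top_iff.2 fun x _ =>
      mem_secondCenter_iff_mem_upperCentralSeries.1 (mem_secondCenter.2 fun y => hcon y x)
    rw [Subgroup.upperCentralSeries_eq_top_iff_nilpotencyClass_le] at h2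
    omega

end Counting

theorem theorem1p2 {G : Type*} [Group G] [Finite G] (p n : ℕ) (hp : p.Prime)
    (hG : IsPGroup p G) (hclass : Group.nilpotencyClass G = 3)
    (htype : IsConjugateType G (p ^ (2 * n))) :
    commPr (1 : G) = ((p : ℚ) ^ (3 * n) + (p : ℚ) ^ (2 * n) - 1) / (p : ℚ) ^ (5 * n) ∧
    (∀ g ∈ commutator G, g ≠ 1 →
      commPr g = ((p : ℚ) ^ (2 * n) - 1) / (p : ℚ) ^ (5 * n)) ∧
    (commPrSet G).ncard = 1 := by
  have : Fact p.Prime := ⟨hp⟩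
  have : Group.IsNilpotent G := hG.isNilpotent
  have hpow : ∀ k, (p : ℚ) ^ (k * n) = ((p ^ n : ℕ) : ℚ) ^ k := fun k => by
    rw [mul_comm, pow_mul, Nat.cast_pow]
  rw [mul_comm, pow_mul] at htype
  have h := isClassThreeOfConjugateType_of_nilpotencyClass hclass htype
  simp only [hpow]
  refine ⟨h.commPr_one, fun g hg hg1 => h.commPr_of_ne_one hg hg1, ?_⟩
  rw [Set.ncard_eq_one]
  refine ⟨(((p ^ n : ℕ) : ℚ) ^ 2 - 1) / ((p ^ n : ℕ) : ℚ) ^ 5, Set.Subset.antisymm ?_ ?_⟩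
  · rintro _ ⟨_, ⟨x, y, rfl⟩, hg1, rfl⟩
    refine h.commPr_of_ne_one ?_ hg1
    rw [groupComm_eq_commutatorElement_inv]
    exact Subgroup.commutator_mem_commutator (Subgroup.mem_top _) (Subgroup.mem_top _)
  · rintro _ rfl
    -- A noncentral commutator is nontrivial, so the common value is attained.
    obtain ⟨x, y, hxy⟩ := h.exists_notMem
    have hg : groupComm x⁻¹ y⁻¹ = commutatorElement.bracket x y := by
      rw [groupComm_eq_commutatorElement_inv, inv_inv, inv_inv]
    refine ⟨_, ⟨x⁻¹, y⁻¹, hg⟩, fun h1 => hxy (mem_centralizerMod.2 ?_), h.commPr_of_ne_one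
      (Subgroup.commutator_mem_commutator (Subgroup.mem_top _) (Subgroup.mem_top _)) fun h1 => hxy
        (mem_centralizerMod.2 ?_)⟩
    all_goals
      rw [h1]
      exact one_mem _
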